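/- Let $n\ge 1$, let $S^{n-1}$ be the unit sphere of $\mathbb R^n$ with spherical (Lebesgue) measure $du$, and let $\mathcal K_o^n$ be the set of compact convex sets $K\subset\mathbb R^n$ with the origin $o$ in the interior. For $K\in\mathcal K_o^n$ write $\rho_K(u)=\sup\{r>0: ru\in K\}$ and $h_K(u)=\sup_{x\in K}\langle x,u\rangle$ ($u\in S^{n-1}$), and for $\eta\subseteq S^{n-1}$ let $$\boldsymbol\alpha_K^*(\eta)=\Big\{\tfrac{x}{|x|}:\ x\in\partial K,\ \langle x,v\rangle=h_K(v)\text{ for some }v\in\eta\Big\}.$$ Let $\phi:\mathbb R^n\setminus\{o\}\to(0,\infty)$ be continuous and satisfy condition C1): for every fixed $t>0$ the function $\Phi(t,u)=\int_t^\infty\phi(ru)r^{n-1}\,dr$ is finite, positive and continuous in $u\in S^{n-1}$. For a measurable set $E\subseteq\mathbb R^n$ with $o\in\operatorname{int}E$ put $\mathcal V_\phi(E)=\int_{\mathbb R^n\setminus E}\phi(x)\,dx$, and for $K\in\mathcal K_o^n$ let the general dual Orlicz curvature measure of $K$ be the Borel measure on $S^{n-1}$ given by $$\widetilde C_{\phi,\mathcal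 V}(K,\eta)=\int_{\boldsymbol\alpha_K^*(\eta)}\phi(\rho_K(u)u)\,\rho_K(u)^n\,du\qquad(\eta\subseteq S^{n-1}\text{ Borel}).$$ Let $\Omega\subseteq S^{n-1}$ be a closed set that is not contained in any closed hemisphere $\{u\in S^{n-1}:\langle u,v\rangle\ge 0\}$, $v\in S^{n-1}$. For a continuous $f:\Omega\to(0,\infty)$ let $[f]=\bigcap_{u\in\Omega}\{x\in\mathbb R^n:\langle x,u\rangle\le f(u)\}$ be its Wulff shape. Theorem. Let $h_0:\Omega\to(0,\infty)$ and $g:\Omega\to\mathbb R$ be continuous, let $\delta>0$, and for $|t|<\delta$ let $h_t:\Omega\to(0,\infty)$ be given by $$\log h_t(u)=\log h_0(u)+t\,g(u)+o(t,u)\qquad(u\in\Omega),$$ where each $o(t,\cdot):\Omega\to\mathbb R$ is continuous and $o(t,u)/t\to0$ uniformly on $\Omega$ as $t\to0$. Then $[h_t]\in\mathcal K_o^n$ and $\mathcal V_\phi([h_t])<\infty$ for $|t|<\delta$, the function $g$ is integrable on $\Omega$ with respect to $\widetilde C_{\phi,\mathcal V}([h_0],\cdot)$, the function $t\mapsto\mathcal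 V_\phi([h_t])$ is differentiable at $t=0$, and $$\frac{d}{dt}\mathcal V_\phi([h_t])\Big|_{t=0}=-\int_\Omega g(u)\,d\widetilde C_{\phi,\mathcal V}([h_0],u).$$ -/

import Mathlib

namespace DualOrlicz

open MeasureTheory Set Filter Topology
open scoped RealInnerProductSpace ENNReal Pointwise

/-- Euclidean space `ℝⁿ`. -/
abbrev Space (n : ℕ) : Type := EuclideanSpace ℝ (Fin n)

/-- The unit sphere `S^{n-1}` of `ℝⁿ`. -/
abbrev Sph (n : ℕ) : Type := Metric.sphere (0 : Space n) 1

/-- The spherical measure `du` on `S^{n-1}`, normalised so that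
`dx = r^{n-1} dr du` in polar coordinates. -/
noncomputable def sphericalMeasure (n : ℕ) : Measure (Sph n) :=
  (volume : Measure (Space n)).toSphere

/-- `K ∈ 𝒦ₒⁿ`: a convex compact set with the origin in its interior. -/
structure IsConvexBodyO {n : ℕ} (K : Set (Space n)) : Prop where
  convex : Convex ℝ K
  isCompact : IsCompact K
  zero_mem_interior : (0 : Space n) ∈ interior K

/-- The radial function `ρ_K(u) = sup {r > 0 : r u ∈ K}`. -/
noncomputable def radialFn {n : ℕ} (K : Set (Space n)) (u : Sph n) : ℝ :=
  sSup {r : ℝ | 0 < r ∧ r • (u : Space n) ∈ K}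

/-- The support function `h_K(u) = sup {⟨x, u⟩ : x ∈ K}`. -/
noncomputable def supportFn {n : ℕ} (K : Set (Space n)) (u : Sph n) : ℝ :=
  sSup ((fun x : Space n => ⟪x, (u : Space n)⟫) '' K)

/-- The supporting hyperplane `H(K, u) = {x : ⟨x, u⟩ = h_K(u)}`. -/
def supportHyperplane {n : ℕ} (K : Set (Space n)) (u : Sph n) : Set (Space n) :=
  {x | ⟪x, (u : Space n)⟫ = supportFn K u}

/-- The reverse radial Gauss image
`α*_K(η) = {x / |x| : x ∈ ∂K ∩ H(K, v) for some v ∈ η}`. -/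
def reverseRadialGaussImage {n : ℕ} (K : Set (Space n)) (η : Set (Sph n)) : Set (Sph n) :=
  {w | ∃ v ∈ η, ∃ x ∈ frontier K ∩ supportHyperplane K v, (w : Space n) = ‖x‖⁻¹ • x}

/-- `Φ(t, u) = ∫_t^∞ φ(r u) r^{n-1} dr`. -/
noncomputable def radialTail {n : ℕ} (φ : Space n → ℝ) (t : ℝ) (u : Sph n) : ℝ :=
  ∫ r in Ioi t, φ (r • (u : Space n)) * r ^ (n - 1)

/-- Condition C1). The function `φ : ℝⁿ ∖ {o} → (0, ∞)` is given by a function on `ℝⁿ` whose value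
at the origin plays no role. The field `integrableOn` says that `Φ(t, u)` is finite. -/
structure ConditionC1 {n : ℕ} (φ : Space n → ℝ) : Prop where
  continuousOn : ContinuousOn φ {x | x ≠ 0}
  pos : ∀ x : Space n, x ≠ 0 → 0 < φ x
  integrableOn : ∀ t : ℝ, 0 < t → ∀ u : Sph n,
    IntegrableOn (fun r : ℝ => φ (r • (u : Space n)) * r ^ (n - 1)) (Ioi t)
  tail_pos : ∀ t : ℝ, 0 < t → ∀ u : Sph n, 0 < radialTail φ t u
  tail_continuous : ∀ t : ℝ, 0 < t → Continuous (radialTail φ t)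

/-- The general dual Orlicz quermassintegral `𝒱_φ(E) = ∫_{ℝⁿ ∖ E} φ(x) dx`. -/
noncomputable def quermass {n : ℕ} (φ : Space n → ℝ) (E : Set (Space n)) : ℝ :=
  ∫ x in Eᶜ, φ x

/-- The Wulff shape `[f] = ⋂_{u ∈ Ω} {x : ⟨x, u⟩ ≤ f(u)}` of a function `f` on `Ω`
(the values of `f` outside `Ω` play no role). -/
def wulff {n : ℕ} (Ω : Set (Sph n)) (f : Sph n → ℝ) : Set (Space n) :=
  ⋂ u ∈ Ω, {x : Space n | ⟪x, (u : Space n)⟫ ≤ f u}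

/-- `Ω` is not contained in any closed hemisphere `{u : ⟨u, v⟩ ≥ 0}`. -/
def NotInClosedHemisphere {n : ℕ} (Ω : Set (Sph n)) : Prop :=
  ∀ v : Sph n, ¬ Ω ⊆ {u : Sph n | 0 ≤ ⟪(u : Space n), (v : Space n)⟫}

/-- `Ψ_K(u) = φ(ρ_K(u) u) ρ_K(u)ⁿ`. -/
noncomputable def curvatureDensity {n : ℕ} (φ : Space n → ℝ) (K : Set (Space n)) (u : Sph n) : ℝ :=
  φ (radialFn K u • (u : Space n)) * radialFn K u ^ n

/-- The set function `η ↦ ∫_{α*_K(η)} Ψ_K(u) du`. -/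
noncomputable def curvatureSetFn {n : ℕ} (φ : Space n → ℝ) (K : Set (Space n))
    (η : Set (Sph n)) : ℝ≥0∞ :=
  ∫⁻ u in reverseRadialGaussImage K η, ENNReal.ofReal (curvatureDensity φ K u) ∂(sphericalMeasure n)

/-! The set function above is countably additive on Borel sets if `K` is a convex body with the
origin in its interior. This is shown next, so that the measure can be defined. -/

section additivity

variable {n : ℕ} {K : Set (Space n)}

theorem IsConvexBodyO.mem_nhds (hK : IsConvexBodyO K) : K ∈ 𝓝 (0 : Space n) :=
  mem_interior_iff_mem_nhds.1 hK.zero_mem_interior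

theorem IsConvexBodyO.gauge_pos (hK : IsConvexBodyO K) {x : Space n} (hx : x ≠ 0) :
    0 < gauge K x :=
  (_root_.gauge_pos (absorbent_nhds_zero hK.mem_nhds)
    (NormedSpace.isVonNBounded_iff ℝ |>.2 hK.isCompact.isBounded)).2 hx

theorem Sph.ne_zero (u : Sph n) : (u : Space n) ≠ 0 := by
  have h : ‖(u : Space n)‖ = 1 := by simp
  intro h0
  rw [h0] at h
  simp at h

theorem IsConvexBodyO.inner_le_supportFn (hK : IsConvexBodyO K) (v : Sph n) {x : Space n}
    (hx : x ∈ K) : ⟪x, (v : Space n)⟫ ≤ supportFn K v := by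
  apply le_csSup
  · exact (hK.isCompact.image (by fun_prop)).bddAbove
  · exact mem_image_of_mem _ hx

theorem IsConvexBodyO.supportFn_pos (hK : IsConvexBodyO K) (v : Sph n) : 0 < supportFn K v := by
  obtain ⟨r, hr, hrK⟩ := Metric.nhds_basis_closedBall.mem_iff.1 hK.mem_nhds
  have hv : ‖(v : Space n)‖ = 1 := by simp
  have h1 : r • (v : Space n) ∈ K := by
    apply hrK
    simp [norm_smul, hv, abs_of_pos hr]
  have h2 := hK.inner_le_supportFn v h1
  rw [real_inner_smul_left, real_inner_self_eq_norm_sq, hv] at h2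
  linarith

theorem IsConvexBodyO.inner_le_mul_gauge (hK : IsConvexBodyO K) (v : Sph n) (y : Space n) :
    ⟪y, (v : Space n)⟫ ≤ supportFn K v * gauge K y := by
  refine le_of_forall_pos_le_add fun ε hε => ?_
  have hs := hK.supportFn_pos v
  have hlt : gauge K y < gauge K y + ε / supportFn K v := by
    have : 0 < ε / supportFn K v := by positivity
    linarith
  obtain ⟨b, hb, hlt', z, hz, rfl⟩ := exists_lt_of_gauge_lt (absorbent_nhds_zero hK.mem_nhds) hlt
  have h1 := hK.inner_le_supportFn v hz
  have h2 : supportFn K v * b ≤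
      supportFn K v * (gauge K (b • z) + ε / supportFn K v) :=
    mul_le_mul_of_nonneg_left hlt'.le hs.le
  simp only [real_inner_smul_left]
  calc b * ⟪z, (v : Space n)⟫ ≤ b * supportFn K v := mul_le_mul_of_nonneg_left h1 hb.le
    _ ≤ supportFn K v * (gauge K (b • z) + ε / supportFn K v) := by linarith
    _ = _ := by field_simp

theorem IsConvexBodyO.fderiv_le (hK : IsConvexBodyO K) {x : Space n}
    (hx : DifferentiableAt ℝ (gauge K) x) (y : Space n) :
    fderiv ℝ (gauge K) x y ≤ gauge K y := by
  have h1 := hx.hasFDerivAt.hasLineDerivAt y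
  have h2 : HasDerivAt (fun t : ℝ => gauge K (x + t • y)) (fderiv ℝ (gauge K) x y) 0 := h1
  have h3 := (hasDerivAt_iff_tendsto_slope_zero.1 h2).mono_left
    (nhdsWithin_mono (0 : ℝ) (s := Ioi 0) fun t (ht : 0 < t) => ht.ne')
  refine le_of_tendsto h3 ?_
  filter_upwards [self_mem_nhdsWithin] with t (ht : 0 < t)
  have h4 := gauge_add_le hK.convex (absorbent_nhds_zero hK.mem_nhds) x (t • y)
  rw [gauge_smul_of_nonneg ht.le, smul_eq_mul] at h4
  simp only [zero_add, zero_smul, add_zero, smul_eq_mul]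
  rw [inv_mul_le_iff₀ ht]
  linarith

theorem IsConvexBodyO.fderiv_self {x : Space n}
    (hx : DifferentiableAt ℝ (gauge K) x) : fderiv ℝ (gauge K) x x = gauge K x := by
  have h2 : HasDerivAt (fun t : ℝ => gauge K (x + t • x)) (fderiv ℝ (gauge K) x x) 0 :=
    hx.hasFDerivAt.hasLineDerivAt x
  have h3 : HasDerivAt (fun t : ℝ => (1 + t) * gauge K x) (gauge K x) 0 := by
    simpa using ((hasDerivAt_id (0 : ℝ)).const_add 1).mul_const (gauge K x)
  refine h2.unique (h3.congr_of_eventuallyEq ?_)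
  filter_upwards [lt_mem_nhds (show (-1 : ℝ) < 0 by norm_num)] with t ht
  have h4 : x + t • x = (1 + t) • x := by module
  rw [h4, gauge_smul_of_nonneg (by linarith), smul_eq_mul]

theorem IsConvexBodyO.fderiv_unique {x : Space n}
    (hx : DifferentiableAt ℝ (gauge K) x) (l : Space n →L[ℝ] ℝ) (hl : ∀ y, l y ≤ gauge K y)
    (hlx : l x = gauge K x) : fderiv ℝ (gauge K) x = l := by
  have h1 : IsLocalMin (fun y => gauge K y - l y) x := by
    refine Eventually.of_forall fun y => ?_
    have := hl y
    simp only [hlx]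
    linarith
  have h2 := h1.hasFDerivAt_eq_zero (hx.hasFDerivAt.sub l.hasFDerivAt)
  exact sub_eq_zero.1 h2

/-- The outer unit normal of `K` at the boundary point in direction `u`, where it is unique. -/
noncomputable def radialGaussMap (K : Set (Space n)) (u : Sph n) : Space n :=
  ‖gradient (gauge K) (u : Space n)‖⁻¹ • gradient (gauge K) (u : Space n)

theorem IsConvexBodyO.mem_image_iff (hK : IsConvexBodyO K) {u : Sph n}
    (hu : DifferentiableAt ℝ (gauge K) (u : Space n)) (η : Set (Sph n)) :
    u ∈ reverseRadialGaussImage K η ↔ radialGaussMap K u ∈ Subtype.val '' η := by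
  have hgu : 0 < gauge K (u : Space n) := hK.gauge_pos (Sph.ne_zero u)
  have hgrad : ∀ y, ⟪y, gradient (gauge K) (u : Space n)⟫ = fderiv ℝ (gauge K) (u : Space n) y := by
    intro y
    rw [real_inner_comm, gradient, InnerProductSpace.toDual_symm_apply]
  constructor
  · rintro ⟨v, hv, x, ⟨hxf, hxH⟩, hux⟩
    refine ⟨v, hv, ?_⟩
    have hs := hK.supportFn_pos v
    have hvn : ‖(v : Space n)‖ = 1 := by simp
    have hgx : gauge K x = 1 := (gauge_eq_one_iff_mem_frontier hK.convex hK.mem_nhds).2 hxf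
    have hG : gradient (gauge K) (u : Space n) = (supportFn K v)⁻¹ • (v : Space n) := by
      rw [gradient, LinearIsometryEquiv.symm_apply_eq]
      apply fderiv_unique hu
      · intro y
        rw [InnerProductSpace.toDual_apply_apply, real_inner_smul_left, real_inner_comm,
          inv_mul_le_iff₀ hs]
        exact hK.inner_le_mul_gauge v y
      · have hxH' : ⟪x, (v : Space n)⟫ = supportFn K v := hxH
        rw [hux, gauge_smul_of_nonneg (by positivity), hgx, InnerProductSpace.toDual_apply_apply,
          real_inner_smul_left, real_inner_smul_right, real_inner_comm, hxH', smul_eq_mul]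
        field_simp
    rw [radialGaussMap, hG, norm_smul, hvn, smul_smul, norm_inv, Real.norm_of_nonneg hs.le,
      mul_one, inv_inv, mul_inv_cancel₀ hs.ne', one_smul]
  · rintro ⟨v, hv, hvG⟩
    set p := gradient (gauge K) (u : Space n) with hp
    have hpne : p ≠ 0 := by
      intro h0
      have := hgrad u
      rw [h0, inner_zero_right, fderiv_self hu] at this
      exact hgu.ne this
    have hpn : 0 < ‖p‖ := norm_pos_iff.2 hpne
    have hinner : ∀ y, ⟪y, (v : Space n)⟫ = ‖p‖⁻¹ * fderiv ℝ (gauge K) (u : Space n) y := by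
      intro y
      rw [hvG, radialGaussMap, real_inner_smul_right, hgrad]
    have hfr : (gauge K (u : Space n))⁻¹ • (u : Space n) ∈ frontier K := by
      rw [← gauge_eq_one_iff_mem_frontier hK.convex hK.mem_nhds,
        gauge_smul_of_nonneg (by positivity), smul_eq_mul, inv_mul_cancel₀ hgu.ne']
    have hin : ⟪(gauge K (u : Space n))⁻¹ • (u : Space n), (v : Space n)⟫ = ‖p‖⁻¹ := by
      rw [hinner, map_smul, fderiv_self hu, smul_eq_mul, inv_mul_cancel₀ hgu.ne', mul_one]
    refine ⟨v, hv, (gauge K (u : Space n))⁻¹ • (u : Space n), ⟨hfr, ?_⟩, ?_⟩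
    · refine le_antisymm (hK.inner_le_supportFn v (hK.isCompact.isClosed.frontier_subset hfr)) ?_
      rw [hin]
      refine csSup_le ⟨_, mem_image_of_mem _ (interior_subset hK.zero_mem_interior)⟩ ?_
      rintro _ ⟨y, hy, rfl⟩
      show ⟪y, (v : Space n)⟫ ≤ _
      rw [hinner]
      have h1 := (hK.fderiv_le hu y).trans (gauge_le_one_of_mem hy)
      calc ‖p‖⁻¹ * fderiv ℝ (gauge K) (u : Space n) y ≤ ‖p‖⁻¹ * 1 := by gcongr
        _ = ‖p‖⁻¹ := mul_one _
    · have hun : ‖(u : Space n)‖ = 1 := by simp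
      rw [norm_smul, hun, norm_inv, Real.norm_of_nonneg hgu.le, mul_one, inv_inv, smul_smul,
        mul_inv_cancel₀ hgu.ne', one_smul]

theorem differentiableAt_smul {r : ℝ} (hr : 0 < r) {x : Space n}
    (hx : DifferentiableAt ℝ (gauge K) (r • x)) : DifferentiableAt ℝ (gauge K) x := by
  have h1 : DifferentiableAt ℝ (fun y : Space n => r⁻¹ * gauge K (r • y)) x :=
    (DifferentiableAt.comp x hx (by fun_prop)).const_mul _
  refine h1.congr_of_eventuallyEq (Eventually.of_forall fun y => ?_)
  simp only [gauge_smul_of_nonneg hr.le, smul_eq_mul]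
  field_simp

theorem IsConvexBodyO.ae_differentiableAt (hK : IsConvexBodyO K) :
    ∀ᵐ u : Sph n ∂(sphericalMeasure n), DifferentiableAt ℝ (gauge K) (u : Space n) := by
  obtain ⟨C, hC⟩ := hK.convex.lipschitz_gauge hK.mem_nhds
  have h1 : ∀ᵐ x ∂(volume : Measure (Space n)), DifferentiableAt ℝ (gauge K) x :=
    hC.ae_differentiableAt
  have hm : MeasurableSet {u : Sph n | ¬ DifferentiableAt ℝ (gauge K) (u : Space n)} :=
    ((measurableSet_of_differentiableAt ℝ (gauge K)).compl).preimage measurable_subtype_coe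
  have h2 : volume {x : Space n | ¬ DifferentiableAt ℝ (gauge K) x} = 0 := h1
  show sphericalMeasure n {u : Sph n | ¬ DifferentiableAt ℝ (gauge K) (u : Space n)} = 0
  rw [sphericalMeasure, Measure.toSphere_apply' _ hm]
  refine mul_eq_zero.2 (Or.inr (measure_mono_null ?_ h2))
  rintro _ ⟨r, hr, _, ⟨u, hu, rfl⟩, rfl⟩
  exact fun h => hu (differentiableAt_smul hr.1 h)

theorem measurable_radialGaussMap (K : Set (Space n)) : Measurable (radialGaussMap K) := by
  have h : Measurable fun u : Sph n => gradient (gauge K) (u : Space n) :=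
    ((InnerProductSpace.toDual ℝ (Space n)).symm.continuous.measurable.comp
      (measurable_fderiv ℝ (gauge K))).comp measurable_subtype_coe
  exact h.norm.inv.smul h

theorem IsConvexBodyO.nullMeasurableSet_image (hK : IsConvexBodyO K) {η : Set (Sph n)}
    (hη : MeasurableSet η) :
    NullMeasurableSet (reverseRadialGaussImage K η) (sphericalMeasure n) := by
  have h1 : MeasurableSet (radialGaussMap K ⁻¹' (Subtype.val '' η)) :=
    measurable_radialGaussMap K
      (Metric.isClosed_sphere.measurableSet.subtype_image hη)
  refine h1.nullMeasurableSet.congr ?_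
  filter_upwards [hK.ae_differentiableAt] with u hu
  exact propext (hK.mem_image_iff hu η).symm

theorem reverseRadialGaussImage_iUnion (K : Set (Space n)) (η : ℕ → Set (Sph n)) :
    reverseRadialGaussImage K (⋃ i, η i) = ⋃ i, reverseRadialGaussImage K (η i) := by
  ext u
  constructor
  · rintro ⟨v, hv, h⟩
    obtain ⟨i, hi⟩ := mem_iUnion.1 hv
    exact mem_iUnion.2 ⟨i, v, hi, h⟩
  · intro h
    obtain ⟨i, v, hi, h⟩ := mem_iUnion.1 h
    exact ⟨v, mem_iUnion.2 ⟨i, hi⟩, h⟩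

theorem curvatureSetFn_empty (φ : Space n → ℝ) (K : Set (Space n)) :
    curvatureSetFn φ K ∅ = 0 := by
  have : reverseRadialGaussImage K ∅ = ∅ := by
    ext u
    simp [reverseRadialGaussImage]
  simp [curvatureSetFn, this]

theorem IsConvexBodyO.curvatureSetFn_iUnion (hK : IsConvexBodyO K) (φ : Space n → ℝ)
    ⦃η : ℕ → Set (Sph n)⦄ (hη : ∀ i, MeasurableSet (η i))
    (hd : Pairwise (Function.onFun Disjoint η)) :
    curvatureSetFn φ K (⋃ i, η i) = ∑' i, curvatureSetFn φ K (η i) := by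
  simp only [curvatureSetFn]
  rw [reverseRadialGaussImage_iUnion, lintegral_iUnion₀ fun i => hK.nullMeasurableSet_image (hη i)]
  intro i j hij
  refine measure_mono_null ?_ (ae_iff.1 hK.ae_differentiableAt)
  rintro u ⟨hi, hj⟩ hu
  obtain ⟨v, hv, hvu⟩ := (hK.mem_image_iff hu _).1 hi
  obtain ⟨w, hw, hwu⟩ := (hK.mem_image_iff hu _).1 hj
  have hvw : v = w := Subtype.ext (hvu.trans hwu.symm)
  exact (hd hij).le_bot ⟨hv, hvw ▸ hw⟩

end additivity

open Classical in
/-- The general dual Orlicz curvature measure `C̃_{φ,𝒱}(K, ·)` of a convex body `K` with the origin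
in its interior: the Borel measure `η ↦ ∫_{α*_K(η)} φ(ρ_K(u) u) ρ_K(u)ⁿ du` on `S^{n-1}`. For other
sets `K` the value is zero by convention. -/
noncomputable def curvatureMeasure {n : ℕ} (φ : Space n → ℝ) (K : Set (Space n)) :
    Measure (Sph n) :=
  if hK : IsConvexBodyO K then
    Measure.ofMeasurable (fun η _ => curvatureSetFn φ K η) (curvatureSetFn_empty φ K)
      (hK.curvatureSetFn_iUnion φ)
  else 0

theorem curvatureMeasure_apply {n : ℕ} (φ : Space n → ℝ) {K : Set (Space n)}
    (hK : IsConvexBodyO K) {η : Set (Sph n)} (hη : MeasurableSet η) :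
    curvatureMeasure φ K η = ∫⁻ u in reverseRadialGaussImage K η,
      ENNReal.ofReal (φ (radialFn K u • (u : Space n)) * radialFn K u ^ n)
        ∂(sphericalMeasure n) := by
  rw [curvatureMeasure, dif_pos hK, Measure.ofMeasurable_apply _ hη]
  rfl

end DualOrlicz

/-!
Fix a direction `u`. Since `Ω` lies in no closed hemisphere, the gauge of the Wulff shape `[h_t]` is
a maximum of linear functionals, `gauge [h_t] u = max_{v ∈ Ω} ⟪u, v⟫ / h_t v`
(`inner_div_le_gauge_wulff`, `exists_gauge_wulff_eq`), and
`1 / h_t v = exp (-(t * g v + o t v)) / h_0 v`. Where the gauge of `[h_0]` is differentiable, which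
is almost everywhere, the maximiser for `t = 0` is unique, namely the Gauss map `ν u`
(`sphGaussMap_wulff_eq`). By the envelope theorem `hasDerivAt_log_max` the logarithm of the radial
function `ρ_t u = 1 / gauge [h_t] u` then has derivative `g (ν u)` at `t = 0`.

In polar coordinates `𝒱_φ([h_t]) = ∫ Φ(ρ_t u, u) du` (`IsConvexBodyO.quermass_eq`), with
`Φ = radialTail φ`, and `s ↦ Φ(exp s, u)` has derivative `-φ(exp s • u) (exp s)ⁿ`, which is bounded
on annuli. As `log ρ_t - log ρ_0 = O(t)` uniformly in `u`, dominated differentiation under the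
integral sign yields the derivative `-∫ φ(ρ_0 u • u) (ρ_0 u)ⁿ g (ν u) du`. This equals
`-∫_Ω g` with respect to the curvature measure of `[h_0]`, because that measure is the image under
`ν` of the spherical measure with density `φ(ρ_0 u • u) (ρ_0 u)ⁿ`
(`IsConvexBodyO.curvatureMeasure_eq_map`).
-/

namespace DualOrlicz

open MeasureTheory Set Filter Topology
open scoped RealInnerProductSpace ENNReal Pointwise

/-! ### Wulff shapes -/

section WulffShape

variable {n : ℕ} {Ω : Set (Sph n)} {f : Sph n → ℝ}

theorem mem_wulff {x : Space n} : x ∈ wulff Ω f ↔ ∀ v ∈ Ω, ⟪x, (v : Space n)⟫ ≤ f v := by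
  simp [wulff]

theorem NotInClosedHemisphere.exists_inner_pos (hΩ : NotInClosedHemisphere Ω) {x : Space n}
    (hx : x ≠ 0) : ∃ v ∈ Ω, 0 < ⟪x, (v : Space n)⟫ := by
  have hxn : 0 < ‖x‖ := norm_pos_iff.2 hx
  have hw : -(‖x‖⁻¹ • x) ∈ Metric.sphere (0 : Space n) 1 := by
    simp [norm_smul, hxn.ne']
  obtain ⟨v, hv, hv'⟩ := not_subset.1 (hΩ ⟨_, hw⟩)
  refine ⟨v, hv, ?_⟩
  simp only [mem_ofPred_eq, not_le, inner_neg_right, real_inner_smul_right, Left.neg_neg_iff] at hv'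
  rw [real_inner_comm]
  exact pos_of_mul_pos_right hv' (by positivity)

/-- By compactness of the sphere, the largest inner product of `x` with a vector of `Ω` is
comparable to `‖x‖`. -/
theorem NotInClosedHemisphere.exists_norm_mul_le_inner (hΩ : NotInClosedHemisphere Ω) :
    ∃ c : ℝ, 0 < c ∧ ∀ x : Space n, x ≠ 0 → ∃ v ∈ Ω, c * ‖x‖ ≤ ⟪x, (v : Space n)⟫ := by
  let U : ℕ → Set (Sph n) := fun k =>
    ⋃ v ∈ Ω, {w : Sph n | (1 : ℝ) / (k + 1) < ⟪(w : Space n), (v : Space n)⟫}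
  have hU : ∀ k, IsOpen (U k) := fun k => isOpen_biUnion fun v _ =>
    isOpen_lt continuous_const (by fun_prop)
  have hcov : (univ : Set (Sph n)) ⊆ ⋃ k, U k := by
    intro w _
    obtain ⟨v, hv, hwv⟩ := hΩ.exists_inner_pos (Sph.ne_zero w)
    obtain ⟨k, hk⟩ := exists_nat_one_div_lt hwv
    exact mem_iUnion.2 ⟨k, mem_biUnion hv hk⟩
  have hmono : Monotone U := by
    intro k l hkl
    refine iUnion₂_mono fun v _ w hw => ?_
    have h : (1 : ℝ) / (l + 1) ≤ 1 / (k + 1) :=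
      one_div_le_one_div_of_le (by positivity) (by gcongr)
    exact h.trans_lt hw
  obtain ⟨k, hk⟩ := isCompact_univ.elim_directed_cover U hU hcov hmono.directed_le
  refine ⟨1 / (k + 1), by positivity, fun x hx => ?_⟩
  have hxn : 0 < ‖x‖ := norm_pos_iff.2 hx
  have hw : ‖x‖⁻¹ • x ∈ Metric.sphere (0 : Space n) 1 := by simp [norm_smul, hxn.ne']
  obtain ⟨v, hv, hvx⟩ := mem_iUnion₂.1 (hk (mem_univ (⟨_, hw⟩ : Sph n)))
  refine ⟨v, hv, ?_⟩
  simp only [mem_ofPred_eq, real_inner_smul_left] at hvx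
  rw [lt_inv_mul_iff₀ hxn] at hvx
  linarith

theorem isConvexBodyO_wulff (hΩc : IsClosed Ω) (hΩ : NotInClosedHemisphere Ω)
    (hf : ContinuousOn f Ω) (hpos : ∀ u ∈ Ω, 0 < f u) : IsConvexBodyO (wulff Ω f) := by
  have hΩk : IsCompact Ω := hΩc.isCompact
  refine ⟨?_, ?_, ?_⟩
  · refine convex_iInter₂ fun u _ => convex_halfSpace_le ?_ _
    exact ⟨fun x y => inner_add_left x y _, fun c x => real_inner_smul_left x _ c⟩
  · refine Metric.isCompact_of_isClosed_isBounded ?_ ?_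
    · exact isClosed_biInter fun u _ => isClosed_le (by fun_prop) continuous_const
    · obtain ⟨c, hc, hcx⟩ := hΩ.exists_norm_mul_le_inner
      obtain ⟨H, hH⟩ := (hΩk.image_of_continuousOn hf).bddAbove
      refine (isBounded_iff_forall_norm_le).2 ⟨max (H / c) 0, fun x hx => ?_⟩
      rcases eq_or_ne x 0 with rfl | hx0
      · simp
      obtain ⟨v, hv, hvx⟩ := hcx x hx0
      refine le_trans ?_ (le_max_left _ _)
      rw [le_div_iff₀' hc]
      exact (hvx.trans (mem_wulff.1 hx v hv)).trans (hH (mem_image_of_mem f hv))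
  · rcases Ω.eq_empty_or_nonempty with rfl | hne
    · simp [wulff]
    obtain ⟨v₀, hv₀, hmin⟩ := hΩk.exists_isMinOn hne hf
    refine mem_interior_iff_mem_nhds.2
      (mem_of_superset (Metric.ball_mem_nhds 0 (hpos v₀ hv₀)) fun x hx => ?_)
    refine mem_wulff.2 fun v hv => ?_
    have h1 := real_inner_le_norm x (v : Space n)
    have h2 : f v₀ ≤ f v := hmin hv
    have h3 : ‖x‖ < f v₀ := by simpa using hx
    simp only [norm_eq_of_mem_sphere, mul_one] at h1
    linarith

theorem inner_div_le_gauge_wulff (hK : IsConvexBodyO (wulff Ω f)) {v : Sph n} (hv : v ∈ Ω)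
    (hfv : 0 < f v) (x : Space n) : ⟪x, (v : Space n)⟫ / f v ≤ gauge (wulff Ω f) x := by
  rw [div_le_iff₀ hfv, mul_comm]
  refine (hK.inner_le_mul_gauge v x).trans (mul_le_mul_of_nonneg_right ?_ (gauge_nonneg x))
  refine csSup_le ⟨_, mem_image_of_mem _ (interior_subset hK.zero_mem_interior)⟩ ?_
  rintro _ ⟨y, hy, rfl⟩
  exact mem_wulff.1 hy v hv

/-- The gauge of a Wulff shape is the maximum over `v ∈ Ω` of the linear functionals
`x ↦ ⟪x, v⟫ / f v`; here attainment is asserted, the inequality being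
`inner_div_le_gauge_wulff`. -/
theorem exists_gauge_wulff_eq (hΩc : IsClosed Ω) (hΩ : NotInClosedHemisphere Ω)
    (hf : ContinuousOn f Ω) (hpos : ∀ u ∈ Ω, 0 < f u) {x : Space n} (hx : x ≠ 0) :
    ∃ v ∈ Ω, ⟪x, (v : Space n)⟫ / f v = gauge (wulff Ω f) x := by
  obtain ⟨w, hw, hwx⟩ := hΩ.exists_inner_pos hx
  have hc : ContinuousOn (fun v : Sph n => ⟪x, (v : Space n)⟫ / f v) Ω :=
    ContinuousOn.div (by fun_prop) hf fun v hv => (hpos v hv).ne'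
  obtain ⟨v, hv, hmax⟩ := hΩc.isCompact.exists_isMaxOn ⟨w, hw⟩ hc
  refine ⟨v, hv, le_antisymm
    (inner_div_le_gauge_wulff (isConvexBodyO_wulff hΩc hΩ hf hpos) hv (hpos v hv) x) ?_⟩
  set m := ⟪x, (v : Space n)⟫ / f v with hm
  have hm0 : 0 < m := (div_pos hwx (hpos w hw)).trans_le (hmax hw)
  have hmem : m⁻¹ • x ∈ wulff Ω f := by
    refine mem_wulff.2 fun u hu => ?_
    have h1 : ⟪x, (u : Space n)⟫ / f u ≤ m := hmax hu
    rw [div_le_iff₀ (hpos u hu)] at h1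
    rwa [real_inner_smul_left, inv_mul_le_iff₀ hm0]
  have h2 := gauge_le_one_of_mem hmem
  rw [gauge_smul_of_nonneg (by positivity), smul_eq_mul, inv_mul_le_iff₀ hm0, mul_one] at h2
  exact h2

end WulffShape

/-! ### The radial function -/

section RadialFunction

variable {n : ℕ} {K : Set (Space n)}

theorem IsConvexBodyO.mem_iff_gauge_le_one (hK : IsConvexBodyO K) {x : Space n} :
    x ∈ K ↔ gauge K x ≤ 1 := by
  rw [gauge_le_one_iff_mem_closure hK.convex hK.mem_nhds, hK.isCompact.isClosed.closure_eq]

theorem IsConvexBodyO.gauge_sph_pos (hK : IsConvexBodyO K) (u : Sph n) :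
    0 < gauge K (u : Space n) := hK.gauge_pos (Sph.ne_zero u)

theorem IsConvexBodyO.smul_mem_iff (hK : IsConvexBodyO K) (u : Sph n) {r : ℝ} (hr : 0 < r) :
    r • (u : Space n) ∈ K ↔ r ≤ (gauge K (u : Space n))⁻¹ := by
  rw [hK.mem_iff_gauge_le_one, gauge_smul_of_nonneg hr.le, smul_eq_mul,
    ← le_div_iff₀ (hK.gauge_sph_pos u), one_div]

theorem IsConvexBodyO.radialFn_eq (hK : IsConvexBodyO K) (u : Sph n) :
    radialFn K u = (gauge K (u : Space n))⁻¹ := by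
  have h : {r : ℝ | 0 < r ∧ r • (u : Space n) ∈ K} = Ioc 0 (gauge K (u : Space n))⁻¹ := by
    ext r
    exact and_congr_right fun hr => hK.smul_mem_iff u hr
  rw [radialFn, h, csSup_Ioc (inv_pos.2 (hK.gauge_sph_pos u))]

theorem IsConvexBodyO.radialFn_pos (hK : IsConvexBodyO K) (u : Sph n) : 0 < radialFn K u := by
  rw [hK.radialFn_eq]
  exact inv_pos.2 (hK.gauge_sph_pos u)

theorem IsConvexBodyO.smul_mem_iff_le_radialFn (hK : IsConvexBodyO K) (u : Sph n) {r : ℝ}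
    (hr : 0 < r) : r • (u : Space n) ∈ K ↔ r ≤ radialFn K u := by
  rw [hK.radialFn_eq, hK.smul_mem_iff u hr]

theorem IsConvexBodyO.continuous_radialFn (hK : IsConvexBodyO K) : Continuous (radialFn K) := by
  have h : Continuous (gauge K) := continuous_gauge hK.convex hK.mem_nhds
  rw [funext hK.radialFn_eq]
  exact (h.comp continuous_subtype_val).inv₀ fun u => (hK.gauge_sph_pos u).ne'

end RadialFunction

/-! ### Differentiation of a maximum -/

section Envelope

variable {X : Type*} [TopologicalSpace X]

/-- If two maxima are taken over families which differ by factors in `[e⁻ᶜ, eᶜ]`, then their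
logarithms differ by at most `c`. -/
theorem abs_log_max_sub_le {ι : Type*} {p k : ι → ℝ} {G₀ G₁ c : ℝ} (hG₀ : 0 < G₀)
    (hG₁ : 0 < G₁)
    (hle₀ : ∀ v, p v ≤ G₀) (hex₀ : ∃ v, p v = G₀)
    (hle₁ : ∀ v, p v * Real.exp (-k v) ≤ G₁) (hex₁ : ∃ v, p v * Real.exp (-k v) = G₁)
    (hk : ∀ v, |k v| ≤ c) : |Real.log G₁ - Real.log G₀| ≤ c := by
  obtain ⟨v, hv⟩ := hex₀
  obtain ⟨w, hw⟩ := hex₁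
  have h1 : Real.log G₀ - k v ≤ Real.log G₁ := by
    have h := Real.log_le_log (by rw [hv]; positivity) (hle₁ v)
    rwa [hv, Real.log_mul hG₀.ne' (Real.exp_ne_zero _), Real.log_exp] at h
  have h2 : Real.log G₁ ≤ Real.log G₀ - k w := by
    have h : G₁ ≤ G₀ * Real.exp (-k w) := by
      rw [← hw]
      exact mul_le_mul_of_nonneg_right (hle₀ w) (Real.exp_pos _).le
    have h := Real.log_le_log hG₁ h
    rwa [Real.log_mul hG₀.ne' (Real.exp_ne_zero _), Real.log_exp] at h
  have := abs_le.1 (hk v)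
  have := abs_le.1 (hk w)
  rw [abs_le]
  constructor <;> linarith

/-- Uniform linear bound for a family of functions on a compact space with a uniform derivative
at `0`. -/
theorem exists_abs_le_mul_of_uniform [CompactSpace X] {g : X → ℝ} (hg : Continuous g)
    {o : ℝ → X → ℝ} (ho0 : ∀ v, o 0 v = 0)
    (ho : TendstoUniformly (fun (t : ℝ) v => o t v / t) (fun _ => 0) (𝓝[≠] 0)) :
    ∃ M : ℝ, 0 ≤ M ∧ ∀ᶠ t in 𝓝 (0 : ℝ), ∀ v, |t * g v + o t v| ≤ M * |t| := by
  obtain ⟨C, hC⟩ := isCompact_univ.exists_bound_of_continuousOn hg.continuousOn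
  refine ⟨max C 0 + 1, by positivity, ?_⟩
  have h1 := Metric.tendstoUniformly_iff.1 ho 1 one_pos
  rw [eventually_nhdsWithin_iff] at h1
  filter_upwards [h1] with t ht v
  rcases eq_or_ne t 0 with rfl | ht0
  · simp [ho0]
  have h2 := ht ht0 v
  rw [dist_zero_left, Real.norm_eq_abs, abs_div, div_lt_one (abs_pos.2 ht0)] at h2
  have h3 : |g v| ≤ max C 0 := (hC v (mem_univ _)).trans (le_max_left _ _)
  calc |t * g v + o t v| ≤ |t * g v| + |o t v| := abs_add_le _ _
    _ ≤ |t| * max C 0 + |t| := by rw [abs_mul]; gcongr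
    _ = _ := by ring

/-- Envelope theorem: let `G t` be the maximum over `v` of `p v * exp (-(t * g v + o t v))`. If the
maximum for `t = 0` is attained at `v₀` only, then `log G` has derivative `-g v₀` at `0`. Indeed,
maximisers for `t → 0` converge to `v₀`, and comparing at `v₀` and at the maximisers bounds
`log (G t) - log (G 0) + t * g v₀` from both sides by `o(t)`. -/
theorem hasDerivAt_log_max [CompactSpace X] {p g : X → ℝ} (hp : Continuous p) (hg : Continuous g)
    {o : ℝ → X → ℝ} (ho0 : ∀ v, o 0 v = 0)
    (ho : TendstoUniformly (fun (t : ℝ) v => o t v / t) (fun _ => 0) (𝓝[≠] 0))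
    {G : ℝ → ℝ} {δ : ℝ} (hδ : 0 < δ) (hG : ∀ t, |t| < δ → 0 < G t)
    (hle : ∀ t, |t| < δ → ∀ v, p v * Real.exp (-(t * g v + o t v)) ≤ G t)
    (hex : ∀ t, |t| < δ → ∃ v, p v * Real.exp (-(t * g v + o t v)) = G t)
    {v₀ : X} (hv₀ : p v₀ = G 0) (huniq : ∀ v, p v = G 0 → v = v₀) :
    HasDerivAt (fun t => Real.log (G t)) (-g v₀) 0 := by
  have hδ0 : |(0 : ℝ)| < δ := by simpa
  have hG0 := hG 0 hδ0
  have hle0 : ∀ v, p v ≤ G 0 := fun v => by simpa [ho0] using hle 0 hδ0 v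
  have hnear : ∀ᶠ t in 𝓝 (0 : ℝ), |t| < δ :=
    (continuous_abs.tendsto 0).eventually (gt_mem_nhds hδ0)
  obtain ⟨M, hM, hMk⟩ := exists_abs_le_mul_of_uniform hg ho0 ho
  -- `V t` is a maximiser for the parameter `t`; its value for `|t| ≥ δ` is irrelevant.
  have hchoice : ∀ t, ∃ v, |t| < δ → p v * Real.exp (-(t * g v + o t v)) = G t := by
    intro t
    by_cases ht : |t| < δ
    · obtain ⟨v, hv⟩ := hex t ht
      exact ⟨v, fun _ => hv⟩
    · exact ⟨v₀, fun h => absurd h ht⟩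
  choose V hV using hchoice
  have hlower : ∀ t, |t| < δ → Real.log (G 0) - (t * g v₀ + o t v₀) ≤ Real.log (G t) := by
    intro t ht
    have h := Real.log_le_log (by rw [hv₀]; positivity) (hle t ht v₀)
    rw [hv₀, Real.log_mul hG0.ne' (Real.exp_ne_zero _), Real.log_exp] at h
    linarith
  have hpV : ∀ t, |t| < δ → 0 < p (V t) := fun t ht => by
    have h := hV t ht
    exact pos_of_mul_pos_left (h ▸ hG t ht) (Real.exp_pos _).le
  have hVlog : ∀ t, |t| < δ →
      Real.log (G t) = Real.log (p (V t)) - (t * g (V t) + o t (V t)) := by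
    intro t ht
    rw [← hV t ht, Real.log_mul (hpV t ht).ne' (Real.exp_ne_zero _), Real.log_exp]
    ring
  have hupper : ∀ t, |t| < δ → Real.log (p (V t)) ≤ Real.log (G 0) := fun t ht =>
    Real.log_le_log (hpV t ht) (hle0 _)
  -- The maximisers are almost maximal for `t = 0`, as the factors tend to `1` uniformly.
  have hplim : Tendsto (fun t => p (V t)) (𝓝 0) (𝓝 (G 0)) := by
    have h1 : Tendsto (fun t : ℝ => Real.exp (Real.log (G 0) - 2 * (M * |t|))) (𝓝 0)
        (𝓝 (G 0)) := by
      have h : Continuous fun t : ℝ => Real.exp (Real.log (G 0) - 2 * (M * |t|)) := by fun_prop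
      have h := h.tendsto 0
      simpa [Real.exp_log hG0] using h
    refine tendsto_of_tendsto_of_tendsto_of_le_of_le' h1 tendsto_const_nhds ?_
      (Eventually.of_forall fun t => hle0 _)
    filter_upwards [hnear, hMk] with t ht hk
    rw [← Real.le_log_iff_exp_le (hpV t ht)]
    have h2 := hlower t ht
    have h3 := hVlog t ht
    have h4 := (abs_le.1 (hk v₀)).2
    have h5 := (abs_le.1 (hk (V t))).1
    linarith
  have hVlim : Tendsto V (𝓝 0) (𝓝 v₀) := by
    -- Each cluster point of the maximisers is a maximiser for `t = 0`, hence equal to `v₀`.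
    refine tendsto_nhds_of_unique_mapClusterPt fun w hw => huniq w ?_
    have h1 : MapClusterPt (p w) (𝓝 0) (p ∘ V) := hw.continuousAt_comp hp.continuousAt
    exact eq_of_nhds_neBot (h1.neBot.mono (inf_le_inf_left _ hplim))
  have hglim : Tendsto (fun t => |g (V t) - g v₀|) (𝓝 0) (𝓝 0) := by
    have h := ((hg.tendsto v₀).comp hVlim).sub_const (g v₀) |>.abs
    simpa using h
  rw [hasDerivAt_iff_isLittleO, Asymptotics.isLittleO_iff]
  intro c hc
  have h1 := Metric.tendstoUniformly_iff.1 ho (c / 4) (by positivity)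
  rw [eventually_nhdsWithin_iff] at h1
  filter_upwards [h1, hnear, hglim.eventually (gt_mem_nhds (show 0 < c / 2 by positivity))]
    with t ht htδ hgt
  have ho' : ∀ v, |o t v| ≤ c / 4 * |t| := by
    intro v
    rcases eq_or_ne t 0 with rfl | ht0
    · simp [ho0]
    have h := ht ht0 v
    rw [dist_zero_left, Real.norm_eq_abs, abs_div, div_lt_iff₀ (abs_pos.2 ht0)] at h
    exact h.le
  have hgV : |t * (g (V t) - g v₀)| ≤ c / 2 * |t| := by
    rw [abs_mul, mul_comm]
    gcongr
  have h2 := hlower t htδ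
  have h3 := hVlog t htδ
  have h4 := hupper t htδ
  have h5 := abs_le.1 (ho' v₀)
  have h6 := abs_le.1 (ho' (V t))
  have h7 := abs_le.1 hgV
  have h8 : 0 ≤ c * |t| := by positivity
  simp only [sub_zero, smul_eq_mul, Real.norm_eq_abs]
  rw [abs_le]
  constructor <;> nlinarith

end Envelope

/-! ### Polar coordinates -/

section Polar

variable {n : ℕ}

instance instIsFiniteMeasureSphericalMeasure : IsFiniteMeasure (sphericalMeasure n) :=
  inferInstanceAs (IsFiniteMeasure (volume : Measure (Space n)).toSphere)

/-- The polar coordinate map of Mathlib, with the exponent of its radial density written in terms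
of `n`. -/
theorem measurePreserving_polar (n : ℕ) :
    MeasurePreserving (homeomorphUnitSphereProd (Space n))
      ((volume : Measure (Space n)).comap (↑))
      ((sphericalMeasure n).prod (Measure.volumeIoiPow (n - 1))) := by
  have h := (volume : Measure (Space n)).measurePreserving_homeomorphUnitSphereProd
  rwa [finrank_euclideanSpace_fin] at h

theorem comp_polar (F : Space n → ℝ) :
    (fun p : Sph n × Ioi (0 : ℝ) => F (p.2.1 • (p.1 : Space n))) ∘
      homeomorphUnitSphereProd (Space n) = fun x => F x.1 := by
  funext x
  have hx : ‖(x : Space n)‖ ≠ 0 := norm_ne_zero_iff.2 x.2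
  simp only [Function.comp_apply, homeomorphUnitSphereProd_apply_snd_coe,
    homeomorphUnitSphereProd_apply_fst_coe, smul_smul, mul_inv_cancel₀ hx, one_smul]

theorem restrict_compl_zero (hn : 1 ≤ n) :
    (volume : Measure (Space n)).restrict {0}ᶜ = volume := by
  have : NeZero n := ⟨by omega⟩
  exact restrict_compl_singleton 0

theorem integrable_polar_iff (hn : 1 ≤ n) (F : Space n → ℝ) :
    Integrable (fun p : Sph n × Ioi (0 : ℝ) => F (p.2.1 • (p.1 : Space n)))
      ((sphericalMeasure n).prod (Measure.volumeIoiPow (n - 1))) ↔ Integrable F := by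
  rw [← (measurePreserving_polar n).integrable_comp_emb (Homeomorph.measurableEmbedding _),
    comp_polar]
  conv_rhs => rw [← restrict_compl_zero hn]
  exact (integrableOn_iff_comap_subtypeVal (by measurability)).symm

theorem aestronglyMeasurable_polar {F : Space n → ℝ} (hF : AEStronglyMeasurable F) :
    AEStronglyMeasurable (fun p : Sph n × Ioi (0 : ℝ) => F (p.2.1 • (p.1 : Space n)))
      ((sphericalMeasure n).prod (Measure.volumeIoiPow (n - 1))) := by
  rw [← (measurePreserving_polar n).aestronglyMeasurable_comp_iff
    (Homeomorph.measurableEmbedding _), comp_polar]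
  have hm : MeasurableSet ({0}ᶜ : Set (Space n)) := (measurableSet_singleton _).compl
  rw [← Function.comp_def F, ← (MeasurableEmbedding.subtype_coe hm).aestronglyMeasurable_map_iff,
    map_comap_subtype_coe hm]
  exact hF.restrict

theorem integral_polar (hn : 1 ≤ n) (F : Space n → ℝ) :
    ∫ p : Sph n × Ioi (0 : ℝ), F (p.2.1 • (p.1 : Space n))
      ∂((sphericalMeasure n).prod (Measure.volumeIoiPow (n - 1))) = ∫ x, F x := by
  rw [← (measurePreserving_polar n).integral_comp (Homeomorph.measurableEmbedding _)]
  have h := comp_polar F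
  simp only [Function.comp_def] at h
  rw [h, integral_subtype_comap (by measurability) F, restrict_compl_zero hn]

theorem integrable_volumeIoiPow_iff (m : ℕ) (f : ℝ → ℝ) :
    Integrable (fun r : Ioi (0 : ℝ) => f r) (Measure.volumeIoiPow m) ↔
      IntegrableOn (fun r : ℝ => f r * r ^ m) (Ioi 0) := by
  rw [Measure.volumeIoiPow, integrable_withDensity_iff_integrable_smul' (by fun_prop) (by simp),
    integrableOn_iff_comap_subtypeVal (by measurability)]
  refine integrable_congr (Eventually.of_forall fun r => ?_)
  have hr : (0 : ℝ) < r := r.2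
  simp [ENNReal.toReal_ofReal (pow_nonneg hr.le m), mul_comm]

theorem integral_volumeIoiPow (m : ℕ) (f : ℝ → ℝ) :
    ∫ r : Ioi (0 : ℝ), f r ∂(Measure.volumeIoiPow m) = ∫ r in Ioi (0 : ℝ), f r * r ^ m := by
  rw [Measure.volumeIoiPow, integral_withDensity_eq_integral_toReal_smul (by fun_prop) (by simp),
    ← integral_subtype_comap measurableSet_Ioi fun r : ℝ => f r * r ^ m]
  refine integral_congr_ae (Eventually.of_forall fun r => ?_)
  have hr : (0 : ℝ) < r := r.2
  simp [ENNReal.toReal_ofReal (pow_nonneg hr.le m), mul_comm]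

end Polar

section Quermass

variable {n : ℕ} {K : Set (Space n)} {φ : Space n → ℝ}

theorem indicator_compl_smul (hK : IsConvexBodyO K) (u : Sph n) {r : ℝ} (hr : 0 < r) :
    Kᶜ.indicator φ (r • (u : Space n)) * r ^ (n - 1) =
      (Ioi (radialFn K u)).indicator (fun r => φ (r • (u : Space n)) * r ^ (n - 1)) r := by
  have h := hK.smul_mem_iff_le_radialFn u hr
  by_cases hru : r ≤ radialFn K u
  · simp [h.2 hru, hru]
  · have h' : r • (u : Space n) ∉ K := fun hm => hru (h.1 hm)
    simp [h', not_le.1 hru]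

/-- On the ray through `u` the complement of `K` is the half-line `r > ρ_K(u)`, so that the
finiteness of `Φ(ρ_K(u), u)` is integrability along the ray. -/
theorem integrable_indicator_ray (hφ : ConditionC1 φ) (hK : IsConvexBodyO K) (u : Sph n) :
    Integrable (fun r : Ioi (0 : ℝ) => Kᶜ.indicator φ (r.1 • (u : Space n)))
      (Measure.volumeIoiPow (n - 1)) := by
  rw [integrable_volumeIoiPow_iff _ fun r => Kᶜ.indicator φ (r • (u : Space n)),
    integrableOn_congr_fun (s := Ioi 0) (fun r hr => indicator_compl_smul hK u hr)
      measurableSet_Ioi]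
  exact ((integrable_indicator_iff measurableSet_Ioi).2
    (hφ.integrableOn _ (hK.radialFn_pos u) u)).integrableOn

theorem integral_indicator_ray (hK : IsConvexBodyO K) (u : Sph n) :
    ∫ r : Ioi (0 : ℝ), Kᶜ.indicator φ (r.1 • (u : Space n)) ∂(Measure.volumeIoiPow (n - 1)) =
      radialTail φ (radialFn K u) u := by
  rw [integral_volumeIoiPow _ fun r => Kᶜ.indicator φ (r • (u : Space n)),
    setIntegral_congr_fun measurableSet_Ioi (fun r hr => indicator_compl_smul hK u hr),
    setIntegral_indicator measurableSet_Ioi, radialTail]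
  congr 2
  exact inter_eq_right.2 (Ioi_subset_Ioi (hK.radialFn_pos u).le)

theorem IsConvexBodyO.exists_le_radialFn (hK : IsConvexBodyO K) :
    ∃ c : ℝ, 0 < c ∧ ∀ u, c ≤ radialFn K u := by
  obtain ⟨r, hr, hrK⟩ := Metric.nhds_basis_closedBall.mem_iff.1 hK.mem_nhds
  refine ⟨r, hr, fun u => (hK.smul_mem_iff_le_radialFn u hr).1 (hrK ?_)⟩
  simp [norm_smul, abs_of_pos hr]

theorem ConditionC1.radialTail_anti (hφ : ConditionC1 φ) {s t : ℝ} (hs : 0 < s) (hst : s ≤ t)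
    (u : Sph n) : radialTail φ t u ≤ radialTail φ s u := by
  refine setIntegral_mono_set (hφ.integrableOn s hs u) ?_ (Ioi_subset_Ioi hst).eventuallyLE
  filter_upwards [ae_restrict_mem measurableSet_Ioi] with r hr
  have hr0 : 0 < r := hs.trans hr
  have := hφ.pos (r • (u : Space n)) (smul_ne_zero hr0.ne' (Sph.ne_zero u))
  simp only [Pi.zero_apply]
  positivity

theorem IsConvexBodyO.aestronglyMeasurable_indicator (hK : IsConvexBodyO K)
    (hφ : ConditionC1 φ) : AEStronglyMeasurable (Kᶜ.indicator φ) := by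
  have hm : MeasurableSet Kᶜ := hK.isCompact.isClosed.measurableSet.compl
  rw [aestronglyMeasurable_indicator_iff hm]
  refine (hφ.continuousOn.mono fun x hx => ?_).aestronglyMeasurable hm
  rintro rfl
  exact hx (interior_subset hK.zero_mem_interior)

/-- `K` contains a ball of some radius `c` about the origin, and then the continuous function
`Φ(c, ·)` on the sphere is an upper bound. -/
theorem IsConvexBodyO.integrable_radialTail (hK : IsConvexBodyO K) (hφ : ConditionC1 φ) :
    Integrable (fun u => radialTail φ (radialFn K u) u) (sphericalMeasure n) := by
  obtain ⟨c, hc, hcK⟩ := hK.exists_le_radialFn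
  have hmeas := (aestronglyMeasurable_polar
    (hK.aestronglyMeasurable_indicator hφ)).integral_prod_right'
  simp only [integral_indicator_ray hK] at hmeas
  have hbound : Integrable (radialTail φ c) (sphericalMeasure n) :=
    (hφ.tail_continuous c hc).integrable_of_hasCompactSupport
      (HasCompactSupport.of_compactSpace _)
  refine hbound.mono' hmeas (Eventually.of_forall fun u => ?_)
  rw [Real.norm_of_nonneg (hφ.tail_pos _ (hK.radialFn_pos u) u).le]
  exact hφ.radialTail_anti hc (hcK u) u

theorem IsConvexBodyO.integrable_indicator_polar (hK : IsConvexBodyO K) (hφ : ConditionC1 φ) :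
    Integrable (fun p : Sph n × Ioi (0 : ℝ) => Kᶜ.indicator φ (p.2.1 • (p.1 : Space n)))
      ((sphericalMeasure n).prod (Measure.volumeIoiPow (n - 1))) := by
  rw [integrable_prod_iff (aestronglyMeasurable_polar (hK.aestronglyMeasurable_indicator hφ))]
  refine ⟨Eventually.of_forall fun u => integrable_indicator_ray hφ hK u,
    (hK.integrable_radialTail hφ).congr (Eventually.of_forall fun u => ?_)⟩
  simp only [← integral_indicator_ray hK]
  refine integral_congr_ae (Eventually.of_forall fun r => ?_)
  refine (Real.norm_of_nonneg (indicator_apply_nonneg fun _ => ?_)).symm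
  exact (hφ.pos _ (smul_ne_zero (ne_of_gt r.2) (Sph.ne_zero u))).le

theorem IsConvexBodyO.integrableOn_compl (hn : 1 ≤ n) (hK : IsConvexBodyO K)
    (hφ : ConditionC1 φ) : IntegrableOn φ Kᶜ := by
  rw [← integrable_indicator_iff hK.isCompact.isClosed.measurableSet.compl,
    ← integrable_polar_iff hn]
  exact hK.integrable_indicator_polar hφ

theorem IsConvexBodyO.quermass_eq (hn : 1 ≤ n) (hK : IsConvexBodyO K) (hφ : ConditionC1 φ) :
    quermass φ K = ∫ u, radialTail φ (radialFn K u) u ∂(sphericalMeasure n) := by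
  rw [quermass, ← integral_indicator hK.isCompact.isClosed.measurableSet.compl,
    ← integral_polar hn, integral_prod _ (hK.integrable_indicator_polar hφ)]
  simp only [integral_indicator_ray hK]

end Quermass

/-! ### Radial tails in logarithmic coordinates -/

section RadialTail

variable {n : ℕ} {K : Set (Space n)} {φ : Space n → ℝ}

theorem ConditionC1.continuousOn_ray (hφ : ConditionC1 φ) (u : Sph n) :
    ContinuousOn (fun r : ℝ => φ (r • (u : Space n)) * r ^ (n - 1)) (Ioi 0) := by
  refine (hφ.continuousOn.comp (by fun_prop) fun r (hr : 0 < r) => ?_).mul (by fun_prop)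
  exact smul_ne_zero hr.ne' (Sph.ne_zero u)

theorem ConditionC1.hasDerivAt_radialTail (hφ : ConditionC1 φ) (u : Sph n) {s : ℝ} (hs : 0 < s) :
    HasDerivAt (fun t => radialTail φ t u) (-(φ (s • (u : Space n)) * s ^ (n - 1))) s := by
  set f : ℝ → ℝ := fun r => φ (r • (u : Space n)) * r ^ (n - 1) with hf
  have hc := hφ.continuousOn_ray u
  have hI : IntegrableOn f (Ioi (s / 2)) := hφ.integrableOn _ (by positivity) u
  have h1 : HasDerivAt (fun t => ∫ r in (s / 2)..t, f r) (f s) s := by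
    refine intervalIntegral.integral_hasDerivAt_right ?_ ?_ (hc.continuousAt (Ioi_mem_nhds hs))
    · rw [intervalIntegrable_iff_integrableOn_Ioc_of_le (by linarith)]
      exact hI.mono_set Ioc_subset_Ioi_self
    · exact hc.stronglyMeasurableAtFilter isOpen_Ioi s hs
  refine (h1.const_sub (radialTail φ (s / 2) u)).congr_of_eventuallyEq ?_
  filter_upwards [lt_mem_nhds (show s / 2 < s by linarith)] with t ht
  have h2 := intervalIntegral.integral_Ioi_sub_Ioi hI ht.le
  simp only [radialTail]
  linarith

/-- The substitution `t = exp s` turns the derivative of `Φ(·, u)` into the density of the curvature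
measure. -/
theorem ConditionC1.hasDerivAt_radialTail_exp (hn : 1 ≤ n) (hφ : ConditionC1 φ) (u : Sph n)
    (s : ℝ) : HasDerivAt (fun s => radialTail φ (Real.exp s) u)
      (-(φ (Real.exp s • (u : Space n)) * Real.exp s ^ n)) s := by
  have h := (hφ.hasDerivAt_radialTail u (Real.exp_pos s)).comp s (Real.hasDerivAt_exp s)
  have hp : Real.exp s ^ n = Real.exp s ^ (n - 1) * Real.exp s := by
    rw [← pow_succ, Nat.sub_add_cancel hn]
  rw [hp, ← mul_assoc, ← neg_mul]
  exact h

/-- `φ` is bounded on annuli, so `s ↦ Φ(exp s, u)` is Lipschitz on intervals, uniformly in `u`. -/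
theorem ConditionC1.exists_lipschitz_radialTail_exp (hn : 1 ≤ n) (hφ : ConditionC1 φ) (a b : ℝ) :
    ∃ C : ℝ, 0 ≤ C ∧ ∀ u : Sph n, ∀ s ∈ Icc a b, ∀ t ∈ Icc a b,
      |radialTail φ (Real.exp t) u - radialTail φ (Real.exp s) u| ≤ C * |t - s| := by
  have hc : Continuous fun q : ℝ × Sph n =>
      φ (Real.exp q.1 • (q.2 : Space n)) * Real.exp q.1 ^ n := by
    refine (hφ.continuousOn.comp_continuous (by fun_prop) fun q => ?_).mul (by fun_prop)
    exact smul_ne_zero (Real.exp_pos _).ne' (Sph.ne_zero _)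
  obtain ⟨C, hC⟩ := (isCompact_Icc.prod isCompact_univ).exists_bound_of_continuousOn
    (s := Icc a b ×ˢ (univ : Set (Sph n))) hc.continuousOn
  refine ⟨max C 0, le_max_right _ _, fun u s hs t ht => ?_⟩
  refine (convex_Icc a b).norm_image_sub_le_of_norm_hasDerivWithin_le
    (fun x _ => (hφ.hasDerivAt_radialTail_exp hn u x).hasDerivWithinAt) (fun x hx => ?_) hs ht
  rw [norm_neg]
  exact (hC (x, u) ⟨hx, mem_univ u⟩).trans (le_max_left _ _)

end RadialTail

/-! ### The curvature measure as a push-forward -/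

section CurvatureMeasure

variable {n : ℕ} {K : Set (Space n)} {φ : Space n → ℝ}

theorem IsConvexBodyO.norm_radialGaussMap (hK : IsConvexBodyO K) {u : Sph n}
    (hu : DifferentiableAt ℝ (gauge K) (u : Space n)) : ‖radialGaussMap K u‖ = 1 := by
  refine norm_smul_inv_norm (𝕜 := ℝ) fun h0 => (hK.gauge_sph_pos u).ne ?_
  rw [gradient, LinearIsometryEquiv.map_eq_zero_iff] at h0
  rw [← IsConvexBodyO.fderiv_self hu, h0, zero_apply]

open Classical in
/-- The radial Gauss map as a map of the sphere to itself. Where `radialGaussMap K` is not a unit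
vector, which can only happen at points where the gauge of `K` is not differentiable, the value is
the point itself. -/
noncomputable def sphGaussMap (K : Set (Space n)) (u : Sph n) : Sph n :=
  ⟨if ‖radialGaussMap K u‖ = 1 then radialGaussMap K u else u, by
    split_ifs with h
    · simpa using h
    · exact u.2⟩

theorem measurable_sphGaussMap (K : Set (Space n)) : Measurable (sphGaussMap K) := by
  have h := measurable_radialGaussMap K
  refine Measurable.subtype_mk (Measurable.ite ?_ h measurable_subtype_coe)
  exact h.norm (measurableSet_singleton 1)

theorem IsConvexBodyO.coe_sphGaussMap (hK : IsConvexBodyO K) {u : Sph n}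
    (hu : DifferentiableAt ℝ (gauge K) (u : Space n)) :
    (sphGaussMap K u : Space n) = radialGaussMap K u :=
  if_pos (hK.norm_radialGaussMap hu)

theorem IsConvexBodyO.continuous_curvatureDensity (hK : IsConvexBodyO K) (hφ : ConditionC1 φ) :
    Continuous (curvatureDensity φ K) := by
  have hr := hK.continuous_radialFn
  refine (hφ.continuousOn.comp_continuous (hr.smul continuous_subtype_val) fun u => ?_).mul
    (hr.pow n)
  exact smul_ne_zero (hK.radialFn_pos u).ne' (Sph.ne_zero u)

theorem IsConvexBodyO.curvatureDensity_nonneg (hK : IsConvexBodyO K) (hφ : ConditionC1 φ)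
    (u : Sph n) : 0 ≤ curvatureDensity φ K u := by
  have hr := hK.radialFn_pos u
  exact mul_nonneg (hφ.pos _ (smul_ne_zero hr.ne' (Sph.ne_zero u))).le (by positivity)

/-- Up to the null set of directions where the gauge is not differentiable, the reverse radial Gauss
image of a set is its preimage under the Gauss map. -/
theorem IsConvexBodyO.curvatureMeasure_eq_map (hK : IsConvexBodyO K) :
    curvatureMeasure φ K = ((sphericalMeasure n).withDensity fun u =>
      ENNReal.ofReal (curvatureDensity φ K u)).map (sphGaussMap K) := by
  ext η hη
  have hm := measurable_sphGaussMap K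
  rw [curvatureMeasure_apply φ hK hη, Measure.map_apply hm hη, withDensity_apply _ (hm hη)]
  refine setLIntegral_congr ?_
  filter_upwards [hK.ae_differentiableAt] with u hu
  refine propext ((hK.mem_image_iff hu η).trans ?_)
  rw [← hK.coe_sphGaussMap hu]
  exact Subtype.val_injective.mem_set_image

theorem IsConvexBodyO.isFiniteMeasure_curvatureMeasure (hK : IsConvexBodyO K)
    (hφ : ConditionC1 φ) : IsFiniteMeasure (curvatureMeasure φ K) := by
  have hi : Integrable (curvatureDensity φ K) (sphericalMeasure n) :=
    (hK.continuous_curvatureDensity hφ).integrable_of_hasCompactSupport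
      (HasCompactSupport.of_compactSpace _)
  have := isFiniteMeasure_withDensity_ofReal hi.2
  rw [hK.curvatureMeasure_eq_map]
  infer_instance

theorem IsConvexBodyO.setIntegral_curvatureMeasure (hK : IsConvexBodyO K) (hφ : ConditionC1 φ)
    {Ω : Set (Sph n)} (hΩ : MeasurableSet Ω) {g : Sph n → ℝ} (hg : ContinuousOn g Ω) :
    ∫ u in Ω, g u ∂(curvatureMeasure φ K) =
      ∫ u, curvatureDensity φ K u * Ω.indicator g (sphGaussMap K u) ∂(sphericalMeasure n) := by
  rw [← integral_indicator hΩ, hK.curvatureMeasure_eq_map,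
    integral_map (measurable_sphGaussMap K).aemeasurable
      ((aestronglyMeasurable_indicator_iff hΩ).2 (hg.aestronglyMeasurable hΩ)),
    integral_withDensity_eq_integral_toReal_smul
      (hK.continuous_curvatureDensity hφ).measurable.ennreal_ofReal (by simp)]
  refine integral_congr_ae (Eventually.of_forall fun u => ?_)
  simp [ENNReal.toReal_ofReal (hK.curvatureDensity_nonneg hφ u)]

/-- At a point of differentiability of the gauge of a Wulff shape, the linear functional for which
the maximum defining the gauge is attained is unique, and is given by the Gauss map. -/
theorem sphGaussMap_wulff_eq {Ω : Set (Sph n)} {f : Sph n → ℝ} (hK : IsConvexBodyO (wulff Ω f))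
    {u : Sph n} (hu : DifferentiableAt ℝ (gauge (wulff Ω f)) (u : Space n)) {v : Sph n}
    (hv : v ∈ Ω) (hfv : 0 < f v)
    (huv : ⟪(u : Space n), (v : Space n)⟫ / f v = gauge (wulff Ω f) (u : Space n)) :
    sphGaussMap (wulff Ω f) u = v := by
  have hG : gradient (gauge (wulff Ω f)) (u : Space n) = (f v)⁻¹ • (v : Space n) := by
    rw [gradient, LinearIsometryEquiv.symm_apply_eq]
    refine IsConvexBodyO.fderiv_unique hu _ (fun y => ?_) ?_
    · rw [InnerProductSpace.toDual_apply_apply, real_inner_smul_left, real_inner_comm,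
        inv_mul_eq_div]
      exact inner_div_le_gauge_wulff hK hv hfv y
    · rw [InnerProductSpace.toDual_apply_apply, real_inner_smul_left, real_inner_comm,
        inv_mul_eq_div, huv]
  refine Subtype.ext ?_
  have hvn : ‖(v : Space n)‖ = 1 := by simp
  rw [hK.coe_sphGaussMap hu, radialGaussMap, hG, norm_smul, hvn, smul_smul, norm_inv,
    Real.norm_of_nonneg hfv.le, mul_one, inv_inv, mul_inv_cancel₀ hfv.ne', one_smul]

end CurvatureMeasure

/-! ### The variational formula -/

section Variation

variable {n : ℕ} {Ω : Set (Sph n)} {φ : Space n → ℝ} {δ : ℝ} {h o : ℝ → Sph n → ℝ} {g : Sph n → ℝ}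

/-- Logarithmic families `log h_t = log h_0 + t g + o(t, ·)`, `|t| < δ`, of positive continuous functions
on a closed set `Ω` of directions which is contained in no closed hemisphere. -/
structure IsLogFamily (Ω : Set (Sph n)) (δ : ℝ) (h o : ℝ → Sph n → ℝ) (g : Sph n → ℝ) :
    Prop where
  isClosed : IsClosed Ω
  notInClosedHemisphere : NotInClosedHemisphere Ω
  delta_pos : 0 < δ
  continuousOn_zero : ContinuousOn (h 0) Ω
  continuousOn_deriv : ContinuousOn g Ω
  pos : ∀ t : ℝ, |t| < δ → ∀ u ∈ Ω, 0 < h t u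
  log_eq : ∀ t : ℝ, |t| < δ → ∀ u ∈ Ω,
    Real.log (h t u) = Real.log (h 0 u) + t * g u + o t u
  continuousOn_remainder : ∀ t : ℝ, |t| < δ → ContinuousOn (o t) Ω
  tendstoUniformlyOn : TendstoUniformlyOn (fun (t : ℝ) (u : Sph n) => o t u / t) (fun _ => 0)
    (𝓝[≠] 0) Ω

namespace IsLogFamily

theorem abs_zero_lt (H : IsLogFamily Ω δ h o g) : |(0 : ℝ)| < δ := by
  simpa using H.delta_pos

theorem remainder_zero (H : IsLogFamily Ω δ h o g) {u : Sph n} (hu : u ∈ Ω) : o 0 u = 0 := by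
  have := H.log_eq 0 H.abs_zero_lt u hu
  linarith

theorem eq_mul_exp (H : IsLogFamily Ω δ h o g) {t : ℝ} (ht : |t| < δ) {u : Sph n} (hu : u ∈ Ω) :
    h t u = h 0 u * Real.exp (t * g u + o t u) := by
  have h1 := H.log_eq t ht u hu
  rw [add_assoc] at h1
  rw [← Real.exp_log (H.pos t ht u hu), h1, Real.exp_add,
    Real.exp_log (H.pos 0 H.abs_zero_lt u hu)]

theorem continuousOn (H : IsLogFamily Ω δ h o g) {t : ℝ} (ht : |t| < δ) :
    ContinuousOn (h t) Ω := by
  have := H.continuousOn_zero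
  have := H.continuousOn_deriv
  have := H.continuousOn_remainder t ht
  have hc : ContinuousOn (fun u => h 0 u * Real.exp (t * g u + o t u)) Ω := by fun_prop
  exact hc.congr fun u hu => H.eq_mul_exp ht hu

theorem isConvexBodyO (H : IsLogFamily Ω δ h o g) {t : ℝ} (ht : |t| < δ) :
    IsConvexBodyO (wulff Ω (h t)) :=
  isConvexBodyO_wulff H.isClosed H.notInClosedHemisphere (H.continuousOn ht) (H.pos t ht)

theorem compactSpace (H : IsLogFamily Ω δ h o g) : CompactSpace Ω :=
  isCompact_iff_compactSpace.1 H.isClosed.isCompact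

theorem inner_div_eq (H : IsLogFamily Ω δ h o g) {t : ℝ} (ht : |t| < δ) (x : Space n) (v : Ω) :
    ⟪x, (v : Space n)⟫ / h 0 v * Real.exp (-(t * g v + o t v)) = ⟪x, (v : Space n)⟫ / h t v := by
  rw [H.eq_mul_exp ht v.2, Real.exp_neg]
  ring

theorem inner_div_mul_exp_le (H : IsLogFamily Ω δ h o g) {t : ℝ} (ht : |t| < δ) (x : Space n)
    (v : Ω) : ⟪x, (v : Space n)⟫ / h 0 v * Real.exp (-(t * g v + o t v)) ≤
      gauge (wulff Ω (h t)) x := by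
  rw [H.inner_div_eq ht]
  exact inner_div_le_gauge_wulff (H.isConvexBodyO ht) v.2 (H.pos t ht v v.2) x

theorem exists_inner_div_mul_exp_eq (H : IsLogFamily Ω δ h o g) {t : ℝ} (ht : |t| < δ)
    {x : Space n} (hx : x ≠ 0) :
    ∃ v : Ω, ⟪x, (v : Space n)⟫ / h 0 v * Real.exp (-(t * g v + o t v)) =
      gauge (wulff Ω (h t)) x := by
  obtain ⟨v, hv, hvx⟩ := exists_gauge_wulff_eq H.isClosed H.notInClosedHemisphere
    (H.continuousOn ht) (H.pos t ht) hx
  exact ⟨⟨v, hv⟩, (H.inner_div_eq ht x ⟨v, hv⟩).trans hvx⟩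

theorem tendstoUniformly_restrict (H : IsLogFamily Ω δ h o g) :
    TendstoUniformly (fun (t : ℝ) (v : Ω) => o t v / t) (fun _ => 0) (𝓝[≠] 0) :=
  tendstoUniformlyOn_iff_tendstoUniformly_comp_coe.1 H.tendstoUniformlyOn

/-- The gauges of the Wulff shapes depend on `t` in a Lipschitz way at `0`, uniformly in the
direction. -/
theorem exists_abs_log_gauge_sub_le (H : IsLogFamily Ω δ h o g) :
    ∃ M : ℝ, 0 ≤ M ∧ ∀ᶠ t in 𝓝 (0 : ℝ), |t| < δ ∧ |t| < 1 ∧ ∀ u : Sph n,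
      |Real.log (gauge (wulff Ω (h t)) u) - Real.log (gauge (wulff Ω (h 0)) u)| ≤ M * |t| := by
  have := H.compactSpace
  obtain ⟨M, hM, hMk⟩ := exists_abs_le_mul_of_uniform
    (continuousOn_iff_continuous_domRestrict.1 H.continuousOn_deriv)
    (o := fun t (v : Ω) => o t v) (fun v => H.remainder_zero v.2) H.tendstoUniformly_restrict
  have hnear : ∀ c : ℝ, 0 < c → ∀ᶠ t in 𝓝 (0 : ℝ), |t| < c := fun c hc =>
    (continuous_abs.tendsto 0).eventually (gt_mem_nhds (by simpa))
  refine ⟨M, hM, ?_⟩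
  filter_upwards [hMk, hnear δ H.delta_pos, hnear 1 one_pos] with t ht htδ ht1
  refine ⟨htδ, ht1, fun u => ?_⟩
  have hrem : ∀ v : Ω, Real.exp (-(0 * g v + o 0 v)) = 1 := fun v => by
    simp [H.remainder_zero v.2]
  refine abs_log_max_sub_le (p := fun v : Ω => ⟪(u : Space n), (v : Space n)⟫ / h 0 v)
    ((H.isConvexBodyO H.abs_zero_lt).gauge_sph_pos u) ((H.isConvexBodyO htδ).gauge_sph_pos u)
    (fun v => ?_) ?_ (fun v => H.inner_div_mul_exp_le htδ u v)
    (H.exists_inner_div_mul_exp_eq htδ (Sph.ne_zero u)) ht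
  · simpa only [hrem, mul_one] using H.inner_div_mul_exp_le H.abs_zero_lt (u : Space n) v
  · simpa only [hrem, mul_one] using H.exists_inner_div_mul_exp_eq H.abs_zero_lt (Sph.ne_zero u)

/-- The gauge is a maximum of the kind treated by the envelope theorem, with a unique maximiser
in almost every direction. -/
theorem hasDerivAt_log_gauge (H : IsLogFamily Ω δ h o g) {u : Sph n}
    (hu : DifferentiableAt ℝ (gauge (wulff Ω (h 0))) (u : Space n)) :
    HasDerivAt (fun t => Real.log (gauge (wulff Ω (h t)) (u : Space n)))
      (-Ω.indicator g (sphGaussMap (wulff Ω (h 0)) u)) 0 := by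
  have := H.compactSpace
  have hK := H.isConvexBodyO H.abs_zero_lt
  have hmax : ∀ v ∈ Ω, ⟪(u : Space n), (v : Space n)⟫ / h 0 v =
      gauge (wulff Ω (h 0)) (u : Space n) → sphGaussMap (wulff Ω (h 0)) u = v :=
    fun v hv => sphGaussMap_wulff_eq hK hu hv (H.pos 0 H.abs_zero_lt v hv)
  obtain ⟨v₀, hv₀, huv₀⟩ := exists_gauge_wulff_eq H.isClosed H.notInClosedHemisphere
    (H.continuousOn H.abs_zero_lt) (H.pos 0 H.abs_zero_lt) (Sph.ne_zero u)
  rw [hmax v₀ hv₀ huv₀, indicator_of_mem hv₀]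
  have hp : Continuous fun v : Ω => ⟪(u : Space n), (v : Space n)⟫ / h 0 v := by
    refine Continuous.div (by fun_prop) ?_ fun v => (H.pos 0 H.abs_zero_lt v v.2).ne'
    exact continuousOn_iff_continuous_domRestrict.1 H.continuousOn_zero
  refine hasDerivAt_log_max (G := fun t => gauge (wulff Ω (h t)) (u : Space n)) hp
    (continuousOn_iff_continuous_domRestrict.1 H.continuousOn_deriv)
    (o := fun t (v : Ω) => o t v) (fun v => H.remainder_zero v.2) H.tendstoUniformly_restrict
    H.delta_pos (fun t ht => (H.isConvexBodyO ht).gauge_sph_pos u)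
    (fun t ht v => H.inner_div_mul_exp_le ht u v)
    (fun t ht => H.exists_inner_div_mul_exp_eq ht (Sph.ne_zero u))
    (v₀ := ⟨v₀, hv₀⟩) huv₀ fun v hv => Subtype.ext ?_
  rw [← hmax v v.2 hv, hmax v₀ hv₀ huv₀]

theorem radialFn_eq_exp (H : IsLogFamily Ω δ h o g) {t : ℝ} (ht : |t| < δ) (u : Sph n) :
    radialFn (wulff Ω (h t)) u = Real.exp (-Real.log (gauge (wulff Ω (h t)) (u : Space n))) := by
  have hK := H.isConvexBodyO ht
  rw [hK.radialFn_eq, Real.exp_neg, Real.exp_log (hK.gauge_sph_pos u)]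

theorem hasDerivAt_radialTail_gauge (hn : 1 ≤ n) (hφ : ConditionC1 φ)
    (H : IsLogFamily Ω δ h o g) {u : Sph n}
    (hu : DifferentiableAt ℝ (gauge (wulff Ω (h 0))) (u : Space n)) :
    HasDerivAt (fun t => radialTail φ (radialFn (wulff Ω (h t)) u) u)
      (-(curvatureDensity φ (wulff Ω (h 0)) u *
        Ω.indicator g (sphGaussMap (wulff Ω (h 0)) u))) 0 := by
  have h1 := (hφ.hasDerivAt_radialTail_exp hn u
    (-Real.log (gauge (wulff Ω (h 0)) (u : Space n)))).comp 0 (H.hasDerivAt_log_gauge hu).neg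
  rw [← H.radialFn_eq_exp H.abs_zero_lt, neg_neg, neg_mul] at h1
  refine h1.congr_of_eventuallyEq ?_
  filter_upwards [(continuous_abs.tendsto 0).eventually (gt_mem_nhds H.abs_zero_lt)] with t ht
  simp only [Function.comp_apply, Pi.neg_apply, H.radialFn_eq_exp ht]

/-- Uniform linear bound for the integrand of the quermassintegral in polar coordinates. -/
theorem exists_abs_radialTail_sub_le (hn : 1 ≤ n) (hφ : ConditionC1 φ)
    (H : IsLogFamily Ω δ h o g) :
    ∃ C : ℝ, ∀ᶠ t in 𝓝 (0 : ℝ), |t| < δ ∧ ∀ u : Sph n,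
      |radialTail φ (radialFn (wulff Ω (h t)) u) u -
        radialTail φ (radialFn (wulff Ω (h 0)) u) u| ≤ C * |t| := by
  have hK := H.isConvexBodyO H.abs_zero_lt
  obtain ⟨M, hM, hMt⟩ := H.exists_abs_log_gauge_sub_le
  have hc : Continuous fun u : Sph n => Real.log (gauge (wulff Ω (h 0)) (u : Space n)) :=
    ((continuous_gauge hK.convex hK.mem_nhds).comp continuous_subtype_val).log
      fun u => (hK.gauge_sph_pos u).ne'
  obtain ⟨B, hB⟩ := isCompact_univ.exists_bound_of_continuousOn hc.continuousOn
  obtain ⟨C, hC, hCL⟩ := hφ.exists_lipschitz_radialTail_exp hn (-(B + M)) (B + M)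
  -- `log ρ_0` takes values in `[-B, B]`, and `log ρ_t` differs from it by at most `M` for `|t| < 1`.
  refine ⟨C * M, ?_⟩
  filter_upwards [hMt] with t ⟨htδ, ht1, ht⟩
  refine ⟨htδ, fun u => ?_⟩
  have h1 := ht u
  have h2 : M * |t| ≤ M := mul_le_of_le_one_right hM ht1.le
  have h3 := abs_le.1 (hB u (mem_univ u))
  have h4 := abs_le.1 (h1.trans h2)
  rw [H.radialFn_eq_exp htδ, H.radialFn_eq_exp H.abs_zero_lt]
  refine (hCL u _ ⟨by linarith, by linarith⟩ _ ⟨by linarith, by linarith⟩).trans ?_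
  rw [mul_assoc]
  refine mul_le_mul_of_nonneg_left ?_ hC
  rwa [neg_sub_neg, abs_sub_comm]

theorem hasDerivAt_quermass (hn : 1 ≤ n) (hφ : ConditionC1 φ) (H : IsLogFamily Ω δ h o g) :
    HasDerivAt (fun t : ℝ => quermass φ (wulff Ω (h t)))
      (-∫ u in Ω, g u ∂(curvatureMeasure φ (wulff Ω (h 0)))) 0 := by
  have hK := H.isConvexBodyO H.abs_zero_lt
  have hΩ := H.isClosed.measurableSet
  obtain ⟨C, hC⟩ := H.exists_abs_radialTail_sub_le hn hφ
  set F' : Sph n → ℝ := fun u => -(curvatureDensity φ (wulff Ω (h 0)) u *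
    Ω.indicator g (sphGaussMap (wulff Ω (h 0)) u)) with hF'
  have hF'm : AEStronglyMeasurable F' (sphericalMeasure n) := by
    classical
    have hgm : Measurable (Ω.indicator g) := by
      rw [← piecewise_eq_indicator]
      exact H.continuousOn_deriv.measurable_piecewise continuousOn_const hΩ
    exact ((hK.continuous_curvatureDensity hφ).measurable.mul
      (hgm.comp (measurable_sphGaussMap _))).neg.aestronglyMeasurable
  have hL : Continuous fun c : ℝ => ContinuousLinearMap.toSpanSingleton ℝ c :=
    (ContinuousLinearMap.toSpanSingletonCLE (𝕜 := ℝ) (E := ℝ)).continuous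
  obtain ⟨hint, hderiv⟩ := hasFDerivAt_integral_of_dominated_loc_of_lip' (𝕜 := ℝ)
    (F := fun t u => radialTail φ (radialFn (wulff Ω (h t)) u) u)
    (F' := fun u => ContinuousLinearMap.toSpanSingleton ℝ (F' u))
    (bound := fun _ => C) (μ := sphericalMeasure n) hC
    (fun t ht => ((H.isConvexBodyO ht.1).integrable_radialTail hφ).aestronglyMeasurable)
    (hK.integrable_radialTail hφ) (hL.comp_aestronglyMeasurable hF'm)
    (Eventually.of_forall fun u t ht => by simpa using ht.2 u) (integrable_const C)
    (by
      filter_upwards [hK.ae_differentiableAt] with u hu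
      exact (H.hasDerivAt_radialTail_gauge hn hφ hu).hasFDerivAt)
  have h1 := hderiv.hasDerivAt
  rw [ContinuousLinearMap.integral_apply hint] at h1
  simp only [ContinuousLinearMap.toSpanSingleton_apply, one_smul, hF', integral_neg] at h1
  rw [hK.setIntegral_curvatureMeasure hφ hΩ H.continuousOn_deriv]
  refine h1.congr_of_eventuallyEq ?_
  filter_upwards [hC] with t ht
  exact (H.isConvexBodyO ht.1).quermass_eq hn hφ

end IsLogFamily

end Variation

end DualOrlicz

theorem theorem4p1 (n : ℕ) (hn : 1 ≤ n)
    (Ω : Set (DualOrlicz.Sph n)) (hΩ : IsClosed Ω) (hΩ' : DualOrlicz.NotInClosedHemisphere Ω)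
    (φ : DualOrlicz.Space n → ℝ) (hφ : DualOrlicz.ConditionC1 φ)
    (δ : ℝ) (hδ : 0 < δ)
    (h o : ℝ → DualOrlicz.Sph n → ℝ) (g : DualOrlicz.Sph n → ℝ)
    (hh0 : ContinuousOn (h 0) Ω) (hg : ContinuousOn g Ω)
    (hpos : ∀ t : ℝ, |t| < δ → ∀ u ∈ Ω, 0 < h t u)
    (hlog : ∀ t : ℝ, |t| < δ → ∀ u ∈ Ω,
      Real.log (h t u) = Real.log (h 0 u) + t * g u + o t u)
    (ho : ∀ t : ℝ, |t| < δ → ContinuousOn (o t) Ω)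
    (ho' : TendstoUniformlyOn (fun (t : ℝ) (u : DualOrlicz.Sph n) => o t u / t) (fun _ => 0)
      (nhdsWithin 0 {0}ᶜ) Ω) :
    (∀ t : ℝ, |t| < δ → DualOrlicz.IsConvexBodyO (DualOrlicz.wulff Ω (h t)) ∧
      MeasureTheory.IntegrableOn φ (DualOrlicz.wulff Ω (h t))ᶜ) ∧
    MeasureTheory.IntegrableOn g Ω
      (DualOrlicz.curvatureMeasure φ (DualOrlicz.wulff Ω (h 0))) ∧
    HasDerivAt (fun t : ℝ => DualOrlicz.quermass φ (DualOrlicz.wulff Ω (h t)))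
      (-∫ u in Ω, g u ∂(DualOrlicz.curvatureMeasure φ (DualOrlicz.wulff Ω (h 0)))) 0 := by
  have H : DualOrlicz.IsLogFamily Ω δ h o g := ⟨hΩ, hΩ', hδ, hh0, hg, hpos, hlog, ho, ho'⟩
  have hK := H.isConvexBodyO H.abs_zero_lt
  have := hK.isFiniteMeasure_curvatureMeasure hφ
  exact ⟨fun t ht => ⟨H.isConvexBodyO ht, (H.isConvexBodyO ht).integrableOn_compl hn hφ⟩,
    hg.integrableOn_compact hΩ.isCompact, H.hasDerivAt_quermass hn hφ⟩
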